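/- Let $C$ be a finitely complete category and let $X : C^{\mathrm{op}} \to \mathrm{Cat}$ be a (strict) functor with small coproducts. This means that for every morphism $u : V \to U$ of $C$ the functor $Xu : XU \to XV$ has a left adjoint $\hat{X}u : XV \to XU$, and that the Beck–Chevalley condition holds: for every pullback square in $C$ with $q : P \to W$, $p : P \to V$, $s : W \to U$, $u : V \to U$ and $s q = u p$, the mate $\hat{X}q \cdot Xp \Rightarrow Xs \cdot \hat{X}u$ of the canonical isomorphism $Xp \cdot Xu \cong Xq \cdot Xs$ is invertible. Let $A$ be a category in $C$, that is, a simplicial object $A : \Delta^{\mathrm{op}} \to C$ such that, for every object $U$ of $C$, the simplicial set $C(U,A)$ is isomorphic to the nerve of a category; here $d_0 : A_1 \to A_0$ is the codomain morphism and $d_1 : A_1 \to A_0$ is the domain morphism. Let $XA$ be the cosimplicial category obtained by applying $X$ to $A$, with cofaces $\partial_r = Xd_r$ and codegeneracies $\iota_r = Xi_r$. Let $\mathrm{Desc}(XA)$ be its descent category: the objects are pairs $(F,f)$ where $F$ is an object of $XA_0$ and $f : \partial_1 F \to \partial_0 F$ is a morphism of $XA_1$ such that $\iota_0 f = 1_F$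 and $\partial_1 f = \partial_0 f \circ \partial_2 f$; a morphism $(F,f) \to (G,g)$ is a morphism $u : F \to G$ of $XA_0$ such that $\partial_0 u \circ f = g \circ \partial_1 u$. Then the forgetful functor $\mathrm{Desc}(XA) \to XA_0$, $(F,f) \mapsto F$, is monadic: it has a left adjoint for which the comparison functor from $\mathrm{Desc}(XA)$ to the category of Eilenberg–Moore algebras of the induced monad is an equivalence, and indeed an isomorphism, of categories. For any choice of the left adjoint $\hat{X}d_0$ of $Xd_0$, the left adjoint of the forgetful functor can be chosen so that the underlying functor of this monad on $XA_0$ is the composite $$XA_0 \xrightarrow{\;Xd_1\;} XA_1 \xrightarrow{\;\hat{X}d_0\;} XA_0.$$ -/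

import Mathlib

open CategoryTheory Opposite Simplicial

universe v₁ u₁ v₂ u₂

namespace ParamCat

/-- A category in `C`: a simplicial object `A` of `C` such that, for every object `U` of `C`,
the simplicial set `C(U, A)` is (isomorphic to) the nerve of a category. With Mathlib's nerve,
`d₀ : A₁ ⟶ A₀` is the codomain and `d₁ : A₁ ⟶ A₀` the domain. The simplicial set `C(U, A)` lives
in the universe of the hom-sets of `C`, so any such category may be taken in that universe. -/
def IsInternalCategory {C : Type u₁} [Category.{v₁} C] (A : SimplicialObject C) : Prop :=
  ∀ U : C, ∃ D : Cat.{v₁, v₁}, Nonempty ((A ⋙ coyoneda.obj (op U) : SSet.{v₁}) ≅ nerve D)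

theorem obj_eq_of_comp_eq {P Q Q' R : Cat.{v₂, u₂}} {f : P ⟶ Q} {g : Q ⟶ R}
    {f' : P ⟶ Q'} {g' : Q' ⟶ R} (h : f ≫ g = f' ≫ g') (x : P) :
    g.toFunctor.obj (f.toFunctor.obj x) = g'.toFunctor.obj (f'.toFunctor.obj x) :=
  congrArg (fun k : P ⟶ R => k.toFunctor.obj x) h

theorem obj_eq_of_comp_eq_id {P Q : Cat.{v₂, u₂}} {f : P ⟶ Q} {g : Q ⟶ P}
    (h : f ≫ g = 𝟙 P) (x : P) : g.toFunctor.obj (f.toFunctor.obj x) = x :=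
  congrArg (fun k : P ⟶ P => k.toFunctor.obj x) h

/-- An object of the descent category of a cosimplicial category `E`: an object `F` of `E₀` with
a morphism `f : ∂₁ F ⟶ ∂₀ F` of `E₁` such that `ι₀ f` is the identity of `F` and `∂₁ f` is the
composite of `∂₂ f` and `∂₀ f`. The `eqToHom`s only account for the cosimplicial identities. -/
structure Desc (E : CosimplicialObject Cat.{v₂, u₂}) where
  obj : E.obj ⦋0⦌
  hom : (E.δ (n := 0) 1).toFunctor.obj obj ⟶ (E.δ (n := 0) 0).toFunctor.obj obj
  unit : (E.σ (n := 0) 0).toFunctor.map hom =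
    eqToHom (obj_eq_of_comp_eq_id (E.δ_comp_σ_succ (i := 0)) obj) ≫
      eqToHom (obj_eq_of_comp_eq_id (E.δ_comp_σ_self (i := 0)) obj).symm
  cocycle : (E.δ (n := 1) 1).toFunctor.map hom =
    eqToHom (obj_eq_of_comp_eq (E.δ_comp_δ (n := 0) (i := 1) (j := 1) le_rfl).symm obj) ≫
      (E.δ (n := 1) 2).toFunctor.map hom ≫
      eqToHom (obj_eq_of_comp_eq (E.δ_comp_δ (n := 0) (i := 0) (j := 1) (Fin.zero_le _)) obj) ≫
      (E.δ (n := 1) 0).toFunctor.map hom ≫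
      eqToHom (obj_eq_of_comp_eq (E.δ_comp_δ (n := 0) (i := 0) (j := 0) le_rfl).symm obj)

namespace Desc

variable {E : CosimplicialObject Cat.{v₂, u₂}}

/-- A morphism `(F, f) ⟶ (G, g)` of descent data: `u : F ⟶ G` in `E₀` with
`∂₀ u ∘ f = g ∘ ∂₁ u`. -/
@[ext]
structure Hom (M N : Desc E) where
  hom : M.obj ⟶ N.obj
  comm : M.hom ≫ (E.δ (n := 0) 0).toFunctor.map hom =
    (E.δ (n := 0) 1).toFunctor.map hom ≫ N.hom

instance : Category (Desc E) where
  Hom := Hom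
  id M := { hom := 𝟙 _, comm := by simp }
  comp f g :=
    { hom := f.hom ≫ g.hom
      comm := by
        rw [Functor.map_comp, Functor.map_comp, Category.assoc, ← g.comm, ← Category.assoc,
          f.comm, Category.assoc] }
  id_comp f := Hom.ext (Category.id_comp f.hom)
  comp_id f := Hom.ext (Category.comp_id f.hom)
  assoc f g h := Hom.ext (Category.assoc f.hom g.hom h.hom)

end Desc

section

variable {C : Type u₁} [Category.{v₁} C] (X : Cᵒᵖ ⥤ Cat.{v₂, u₂})

/-- The reindexing functor `Xu : XU ⥤ XV` along `u : V ⟶ U`. -/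
abbrev reindex {U V : C} (u : V ⟶ U) : X.obj (op U) ⥤ X.obj (op V) :=
  (X.map u.op).toFunctor

theorem reindex_comp_eq {P V W U : C} {q : P ⟶ W} {p : P ⟶ V} {s : W ⟶ U} {u : V ⟶ U}
    (h : q ≫ s = p ≫ u) : reindex X u ⋙ reindex X p = reindex X s ⋙ reindex X q := by
  have h' : X.map u.op ≫ X.map p.op = X.map s.op ≫ X.map q.op := by
    rw [← X.map_comp, ← X.map_comp, ← op_comp, ← op_comp, h]
  exact congrArg Cat.Hom.toFunctor h'

/-- The mate `X̂q · Xp ⟶ Xs · X̂u` of the canonical isomorphism (here an identity)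
`Xp · Xu ≅ Xq · Xs` of a commutative square, with respect to adjunctions `X̂u ⊣ Xu` and
`X̂q ⊣ Xq`. -/
def beckChevalleyMap {P V W U : C} {q : P ⟶ W} {p : P ⟶ V} {s : W ⟶ U} {u : V ⟶ U}
    (h : q ≫ s = p ≫ u)
    {Lu : X.obj (op V) ⥤ X.obj (op U)} (adju : Lu ⊣ reindex X u)
    {Lq : X.obj (op P) ⥤ X.obj (op W)} (adjq : Lq ⊣ reindex X q) :
    reindex X p ⋙ Lq ⟶ Lu ⋙ reindex X s :=
  ((mateEquiv adju adjq).symm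
    (TwoSquare.mk _ _ _ _ (eqToHom (reindex_comp_eq X h)))).natTrans

/-- `X` has small coproducts: every `Xu` has a left adjoint, and for every pullback square the
mate of the canonical isomorphism is invertible (the Beck–Chevalley condition, which does not
depend on the choice of the left adjoints). -/
structure HasSmallCoproducts : Prop where
  isRightAdjoint : ∀ {U V : C} (u : V ⟶ U), (reindex X u).IsRightAdjoint
  beckChevalley : ∀ {P V W U : C} {q : P ⟶ W} {p : P ⟶ V} {s : W ⟶ U} {u : V ⟶ U}
    (h : IsPullback q p s u)
    (Lu : X.obj (op V) ⥤ X.obj (op U)) (adju : Lu ⊣ reindex X u)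
    (Lq : X.obj (op P) ⥤ X.obj (op W)) (adjq : Lq ⊣ reindex X q),
    IsIso (beckChevalleyMap X h.w adju adjq)

/-- The cosimplicial category `XA`, the composite of `A : Δ ⥤ Cᵒᵖ` and `X : Cᵒᵖ ⥤ Cat`. -/
abbrev cosimplicialCat (A : SimplicialObject C) : CosimplicialObject Cat.{v₂, u₂} :=
  A.rightOp ⋙ X

/-- The forgetful functor `Desc XA ⥤ XA₀`, sending `(F, f)` to `F`. -/
def descForget (A : SimplicialObject C) :
    Desc (cosimplicialCat X A) ⥤ X.obj (op (A _⦋0⦌)) where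
  obj M := M.obj
  map f := f.hom

end

end ParamCat

/-! Put T = X̂d₀ · Xd₁. Transposing along X̂d₀ ⊣ Xd₀ turns morphisms f : ∂₁F ⟶ ∂₀F into morphisms
`act adj f` : TF ⟶ F, bijectively, and what remains is to match the descent axioms with the algebra
axioms. Beck–Chevalley enters only through `HasSmallCoproducts.existsUnique_pull`: morphisms out of
Xs(X̂u G) are freely prescribed by their composite, over the pullback, with the restricted unit.
Since A is a category, A₂ = A₁ ×_{A₀} A₁ and A₃ = A₂ ×_{A₀} A₁. Over A₂ there is therefore a unique
`theta` on TF such that the universal `eta` along a first edge, followed by `theta` along the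
second, is `eta` along the composite edge. This makes TF a descent datum: the cocycle condition is
checked over A₃ and the unit condition on degenerate 2-simplices. Restricting `eta` to identities
gives the unit `iota`. Then f is unital iff `act adj f` retracts `iota` (`isUnital_iff`), and a
cocycle iff `act adj f` carries `theta` to f (`isCocycle_iff`). Hence `act adj f` is the counit,
`act adj theta` the multiplication, and the second condition is associativity. -/

namespace ParamCat

/-! ### Restriction of morphisms between reindexed objects -/

section Pull

variable {C : Type u₁} [Category.{v₁} C] (X : Cᵒᵖ ⥤ Cat.{v₂, u₂})

theorem reindex_comp {U V W : C} (w : W ⟶ U) (u : U ⟶ V) :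
    reindex X (w ≫ u) = reindex X u ⋙ reindex X w :=
  congrArg Cat.Hom.toFunctor (X.map_comp u.op w.op)

theorem reindex_id (U : C) : reindex X (𝟙 U) = 𝟭 _ :=
  congrArg Cat.Hom.toFunctor (X.map_id (op U))

theorem reindex_obj {U V W : C} {w : W ⟶ U} {u : U ⟶ V} {v : W ⟶ V} (h : w ≫ u = v)
    (G : X.obj (op V)) : (reindex X w).obj ((reindex X u).obj G) = (reindex X v).obj G := by
  rw [← h, reindex_comp]; rfl

theorem reindex_id_obj {U : C} (G : X.obj (op U)) : (reindex X (𝟙 U)).obj G = G := by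
  rw [reindex_id]; rfl

/-- The restriction along `w` of a morphism between reindexed objects, transported to given
factorizations of the composites. -/
def pull {U V V' W : C} {u : U ⟶ V} {u' : U ⟶ V'} {G : X.obj (op V)} {G' : X.obj (op V')}
    (w : W ⟶ U) (φ : (reindex X u).obj G ⟶ (reindex X u').obj G')
    {v : W ⟶ V} {v' : W ⟶ V'} (h : w ≫ u = v) (h' : w ≫ u' = v') :
    (reindex X v).obj G ⟶ (reindex X v').obj G' :=
  eqToHom (reindex_obj X h G).symm ≫ (reindex X w).map φ ≫ eqToHom (reindex_obj X h' G')

variable {X}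
variable {U V V' V'' W : C} {u : U ⟶ V} {u' : U ⟶ V'} {u'' : U ⟶ V''}
  {G : X.obj (op V)} {G' : X.obj (op V')} {G'' : X.obj (op V'')}

theorem map_eq_pull (w : W ⟶ U) (φ : (reindex X u).obj G ⟶ (reindex X u').obj G')
    {v : W ⟶ V} {v' : W ⟶ V'} (h : w ≫ u = v) (h' : w ≫ u' = v') :
    (reindex X w).map φ = eqToHom (reindex_obj X h G) ≫ pull X w φ h h' ≫
      eqToHom (reindex_obj X h' G').symm := by
  simp [pull]

theorem pull_comp (w : W ⟶ U) (φ : (reindex X u).obj G ⟶ (reindex X u').obj G')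
    (ψ : (reindex X u').obj G' ⟶ (reindex X u'').obj G'')
    {v : W ⟶ V} {v' : W ⟶ V'} {v'' : W ⟶ V''} (h : w ≫ u = v) (h' : w ≫ u' = v')
    (h'' : w ≫ u'' = v'') :
    pull X w (φ ≫ ψ) h h'' = pull X w φ h h' ≫ pull X w ψ h' h'' := by
  simp [pull]

/-- Functoriality of X, with the endpoints of every restriction left free. Later calculations can
thus name them by vertices of a simplex and avoid explicit transports. -/
theorem pull_pull {W' : C} (w' : W' ⟶ W) (w : W ⟶ U)
    (φ : (reindex X u).obj G ⟶ (reindex X u').obj G')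
    {v : W ⟶ V} {v' : W ⟶ V'} (h : w ≫ u = v) (h' : w ≫ u' = v')
    {t : W' ⟶ V} {t' : W' ⟶ V'} (k : w' ≫ v = t) (k' : w' ≫ v' = t') {x : W' ⟶ U}
    (hx : w' ≫ w = x) :
    pull X w' (pull X w φ h h') k k' =
      pull X x φ (by rw [← hx, Category.assoc, h, k]) (by rw [← hx, Category.assoc, h', k']) := by
  subst hx
  have := Functor.congr_hom (reindex_comp X w' w) φ
  simp only [pull, this]
  simp [eqToHom_map]

theorem pull_id_left (φ : (reindex X u).obj G ⟶ (reindex X u').obj G') {w : U ⟶ U}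
    (hw : w = 𝟙 U) {v : U ⟶ V} {v' : U ⟶ V'} (h : w ≫ u = v) (h' : w ≫ u' = v') :
    pull X w φ h h' = eqToHom (by rw [← h, hw, Category.id_comp]) ≫ φ ≫
      eqToHom (by rw [← h', hw, Category.id_comp]) := by
  subst hw
  have := Functor.congr_hom (reindex_id X U) φ
  simp only [pull, this]
  simp

theorem pull_eq_self (φ : (reindex X u).obj G ⟶ (reindex X u').obj G') {w : U ⟶ U}
    (hw : w = 𝟙 U) (h : w ≫ u = u) (h' : w ≫ u' = u') : pull X w φ h h' = φ := by
  simp [pull_id_left φ hw]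

theorem pull_map (w : W ⟶ U) {H H' : X.obj (op V)} (g : H ⟶ H') {v : W ⟶ V}
    (h : w ≫ u = v) : pull X w ((reindex X u).map g) h h = (reindex X v).map g := by
  subst h
  have := Functor.congr_hom (reindex_comp X w u) g
  simp only [pull, this]
  simp

variable (X) in
/-- A morphism of `XU` from a morphism between reindexings along the identity. -/
def ofId {H H' : X.obj (op U)}
    (φ : (reindex X (𝟙 U)).obj H ⟶ (reindex X (𝟙 U)).obj H') : H ⟶ H' :=
  eqToHom (reindex_id_obj X H).symm ≫ φ ≫ eqToHom (reindex_id_obj X H')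

theorem map_ofId {H H' : X.obj (op U)}
    (φ : (reindex X (𝟙 U)).obj H ⟶ (reindex X (𝟙 U)).obj H') (w : W ⟶ U) :
    (reindex X w).map (ofId X φ) = pull X w φ (Category.comp_id _) (Category.comp_id _) := by
  simp [ofId, pull, eqToHom_map]

theorem ofId_comp {H H' H'' : X.obj (op U)}
    (φ : (reindex X (𝟙 U)).obj H ⟶ (reindex X (𝟙 U)).obj H')
    (ψ : (reindex X (𝟙 U)).obj H' ⟶ (reindex X (𝟙 U)).obj H'') :
    ofId X (φ ≫ ψ) = ofId X φ ≫ ofId X ψ := by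
  simp [ofId]

theorem ofId_id (H : X.obj (op U)) : ofId X (𝟙 ((reindex X (𝟙 U)).obj H)) = 𝟙 H := by
  simp [ofId]

theorem ofId_map {H H' : X.obj (op U)} (g : H ⟶ H') :
    ofId X ((reindex X (𝟙 U)).map g) = g := by
  have := Functor.congr_hom (reindex_id X U) g
  simp only [ofId, this]
  simp

theorem ofId_eq_id_iff {H : X.obj (op U)}
    (φ : (reindex X (𝟙 U)).obj H ⟶ (reindex X (𝟙 U)).obj H) : ofId X φ = 𝟙 H ↔ φ = 𝟙 _ := by
  constructor
  · intro h
    have := (map_ofId φ (𝟙 U)).symm.trans (congrArg (reindex X (𝟙 U)).map h)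
    rwa [pull_eq_self _ rfl, CategoryTheory.Functor.map_id] at this
  · rintro rfl
    exact ofId_id H

end Pull

/-! ### Beck–Chevalley as a universal property -/

section BeckChevalley

variable {C : Type u₁} [Category.{v₁} C] {X : Cᵒᵖ ⥤ Cat.{v₂, u₂}}

/-- The Beck–Chevalley condition as a universal property: morphisms out of `Xs (X̂u G)`
correspond to morphisms out of `Xp G` over the pullback. -/
theorem HasSmallCoproducts.existsUnique_pull (hX : HasSmallCoproducts X) {P V W U : C}
    {q : P ⟶ W} {p : P ⟶ V} {s : W ⟶ U} {u : V ⟶ U} (h : IsPullback q p s u)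
    {L : X.obj (op V) ⥤ X.obj (op U)} (adj : L ⊣ reindex X u)
    {V₁ V₂ : C} {a : V ⟶ V₁} {F : X.obj (op V₁)} {s' : W ⟶ V₂} {K : X.obj (op V₂)}
    {v : P ⟶ V₁} {m : P ⟶ U} {v' : P ⟶ V₂} (hv : p ≫ a = v) (hp : p ≫ u = m) (hq : q ≫ s = m)
    (hv' : q ≫ s' = v')
    (ψ : (reindex X v).obj F ⟶ (reindex X v').obj K) :
    ∃! φ : (reindex X s).obj (L.obj ((reindex X a).obj F)) ⟶ (reindex X s').obj K,
      pull X p (adj.unit.app ((reindex X a).obj F)) hv hp ≫ pull X q φ hq hv' = ψ := by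
  have := hX.isRightAdjoint q
  let adjq := Adjunction.ofIsRightAdjoint (reindex X q)
  have := hX.beckChevalley h L adj _ adjq
  subst hv hq hv'
  let β := (beckChevalleyMap X h.w adj adjq).app ((reindex X a).obj F)
  have : IsIso β := inferInstance
  -- The identity characterizing the mate: the restricted unit of `adj` factors as the unit of
  -- `adjq` followed by Xq of the mate.
  have hβ : (reindex X p).map (adj.unit.app ((reindex X a).obj F)) ≫
      eqToHom ((reindex_obj X hp _).trans (reindex_obj X rfl _).symm) =
      adjq.unit.app _ ≫ (reindex X q).map β := by
    have := unit_mateEquiv_symm adj adjq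
      (TwoSquare.mk _ _ _ _ (eqToHom (reindex_comp_eq X h.w))) ((reindex X a).obj F)
    simp only [TwoSquare.mk, eqToHom_app] at this
    exact this
  -- Precomposition with the inverse of β would go the wrong way: this is precomposition with β,
  -- then transposition along `adjq`, hence a bijection.
  let e : ((reindex X s).obj (L.obj ((reindex X a).obj F)) ⟶ (reindex X s').obj K) ≃
      ((reindex X (p ≫ a)).obj F ⟶ (reindex X (q ≫ s')).obj K) :=
    ((asIso β).homFromEquiv.symm.trans (adjq.homEquiv _ _)).trans
      (Iso.homCongr (eqToIso (reindex_obj X rfl F)) (eqToIso (reindex_obj X rfl K)))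
  have he : ∀ φ, e φ = pull X p (adj.unit.app ((reindex X a).obj F)) rfl hp ≫ pull X q φ rfl rfl := by
    intro φ
    have : e φ = eqToHom (reindex_obj X rfl F).symm ≫
        (adjq.unit.app _ ≫ (reindex X q).map β) ≫ (reindex X q).map φ ≫
          eqToHom (reindex_obj X rfl K) := by
      simp [e, Adjunction.homEquiv_unit]
    rw [this, ← hβ]
    simp [pull]
  simp only [← he]
  exact e.bijective.existsUnique ψ

end BeckChevalley

/-! ### Pullback squares from the Segal condition -/

section Segal

open SimplexCategory

/-- A simplex of the nerve of a category is determined by its first edge and its zeroth face,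
which can be prescribed arbitrarily as long as they are composable. -/
theorem nerve_existsUnique_simplex {D : Type u₁} [Category.{v₁} D] {n : ℕ}
    (e : (nerve D) _⦋1⦌) (t : (nerve D) _⦋n + 1⦌)
    (h : (nerve D).map (δ 0).op e = (nerve D).map (const ⦋0⦌ ⦋n + 1⦌ 0).op t) :
    ∃! w : (nerve D) _⦋n + 2⦌, (nerve D).map (δ 0).op w = t ∧
      (nerve D).map (mkOfSucc 0).op w = e := by
  have harrow (w : (nerve D) _⦋n + 2⦌) (i : Fin (n + 1)) :
      (nerve D).map (mkOfSucc i).op ((nerve D).map (δ 0).op w) =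
        (nerve D).map (mkOfSucc i.succ).op w := by
    rw [← Functor.map_comp_apply, ← op_comp, mkOfSucc_δ_gt (j := 0) (i := i) (by simp)]
  have inj {m : ℕ} {x y : (nerve D) _⦋m + 1⦌}
      (hxy : ∀ i, (nerve D).map (mkOfSucc i).op x = (nerve D).map (mkOfSucc i).op y) : x = y :=
    (Nerve.strictSegal D).spineInjective (SSet.Path.ext' hxy)
  -- The spine of the required simplex: `e` placed in front of the spine of `t`, which `h` makes
  -- composable.
  let p : SSet.Path (nerve D) (n + 2) :=
    { vertex := Fin.cases ((nerve D).map (δ 1).op e)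
        (fun i => (nerve D).map (const ⦋0⦌ ⦋n + 1⦌ i).op t)
      arrow := Fin.cases e (fun i => (nerve D).map (mkOfSucc i).op t)
      arrow_src := by
        intro i
        cases i using Fin.cases with
        | zero => rfl
        | succ i => exact ((nerve D).spine (n + 1) t).arrow_src i
      arrow_tgt := by
        intro i
        cases i using Fin.cases with
        | zero => exact h
        | succ i => exact ((nerve D).spine (n + 1) t).arrow_tgt i }
  have hp (i) : (nerve D).map (mkOfSucc i).op ((Nerve.strictSegal D).spineToSimplex p) =
      p.arrow i := (Nerve.strictSegal D).spineToSimplex_arrow i p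
  refine ⟨(Nerve.strictSegal D).spineToSimplex p, ⟨inj fun i => ?_, hp 0⟩, ?_⟩
  · rw [harrow, hp]
    rfl
  · rintro w ⟨rfl, rfl⟩
    refine inj fun i => ?_
    rw [hp]
    cases i using Fin.cases with
    | zero => rfl
    | succ i => exact (harrow w i).symm

variable {C : Type u₁} [Category.{v₁} C] {A : SimplicialObject C}

theorem IsInternalCategory.existsUnique_simplex (hA : IsInternalCategory A) {n : ℕ} {U : C}
    (e : U ⟶ A _⦋1⦌) (t : U ⟶ A _⦋n + 1⦌)
    (h : e ≫ A.map (δ 0).op = t ≫ A.map (const ⦋0⦌ ⦋n + 1⦌ 0).op) :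
    ∃! w : U ⟶ A _⦋n + 2⦌, w ≫ A.map (δ 0).op = t ∧ w ≫ A.map (mkOfSucc 0).op = e := by
  obtain ⟨D, ⟨i⟩⟩ := hA U
  have nat {k l : ℕ} (f : ⦋k⦌ ⟶ ⦋l⦌) (x : U ⟶ A _⦋l⦌) :
      i.hom.app (op ⦋k⦌) (x ≫ A.map f.op) = (nerve D).map f.op (i.hom.app (op ⦋l⦌) x) :=
    NatTrans.naturality_apply i.hom f.op x
  have bij (k : ℕ) : Function.Bijective (fun x : U ⟶ A _⦋k⦌ => i.hom.app (op ⦋k⦌) x) :=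
    (isIso_iff_bijective (i.hom.app (op ⦋k⦌))).1 inferInstance
  obtain ⟨w, ⟨hw₀, hw₁⟩, hw⟩ := nerve_existsUnique_simplex (n := n)
    (i.hom.app (op ⦋1⦌) e) (i.hom.app (op ⦋n + 1⦌) t) (by rw [← nat, ← nat, h])
  obtain ⟨w, rfl⟩ := (bij _).2 w
  refine ⟨w, ⟨(bij _).1 ?_, (bij _).1 ?_⟩, ?_⟩
  · exact (nat _ _).trans hw₀
  · exact (nat _ _).trans hw₁
  · rintro w' ⟨h₀, h₁⟩
    refine (bij _).1 (hw _ ⟨?_, ?_⟩)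
    · rw [← h₀]
      exact (nat _ _).symm
    · rw [← h₁]
      exact (nat _ _).symm

/-- In a category in `C`, the object of `(n + 2)`-simplices is the pullback of the objects of
`(n + 1)`-simplices and of morphisms over the object of objects. -/
theorem IsInternalCategory.isPullback (hA : IsInternalCategory A) (n : ℕ) :
    IsPullback (A.map (δ (n := n + 1) 0).op) (A.map (mkOfSucc (n := n + 2) 0).op)
      (A.map (const ⦋0⦌ ⦋n + 1⦌ 0).op) (A.map (δ (n := 0) 0).op) := by
  have w : A.map (δ (n := n + 1) 0).op ≫ A.map (const ⦋0⦌ ⦋n + 1⦌ 0).op =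
      A.map (mkOfSucc (n := n + 2) 0).op ≫ A.map (δ (n := 0) 0).op := by
    rw [← A.map_comp, ← A.map_comp, ← op_comp, ← op_comp, const_comp, δ_zero_mkOfSucc]
    rfl
  refine ⟨⟨w⟩, ⟨Limits.PullbackCone.IsLimit.mk w
    (fun s => (hA.existsUnique_simplex s.snd s.fst s.condition.symm).choose)
    (fun s => (hA.existsUnique_simplex s.snd s.fst s.condition.symm).choose_spec.1.1)
    (fun s => (hA.existsUnique_simplex s.snd s.fst s.condition.symm).choose_spec.1.2)
    (fun s m h₀ h₁ => ?_)⟩⟩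
  exact (hA.existsUnique_simplex s.snd s.fst s.condition.symm).choose_spec.2 m ⟨h₀, h₁⟩

end Segal

/-! ### Simplicial identities and descent conditions -/

section Free

open SimplexCategory

variable {C : Type u₁} [Category.{v₁} C] {X : Cᵒᵖ ⥤ Cat.{v₂, u₂}} {A : SimplicialObject C}

theorem map_op_comp_map_op {k l m : ℕ} {f : ⦋k⦌ ⟶ ⦋l⦌} {g : ⦋l⦌ ⟶ ⦋m⦌} {h : ⦋k⦌ ⟶ ⦋m⦌}
    (w : f ≫ g = h) : A.map g.op ≫ A.map f.op = A.map h.op := by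
  rw [← A.map_comp, ← op_comp, w]

theorem map_op_comp_map_op_eq_id {k m : ℕ} {f : ⦋k⦌ ⟶ ⦋m⦌} {g : ⦋m⦌ ⟶ ⦋k⦌}
    (w : f ≫ g = 𝟙 _) : A.map g.op ≫ A.map f.op = 𝟙 _ := by
  rw [map_op_comp_map_op w, op_id, A.map_id]

variable (A)

/-- The `i`-th vertex of the object of `n`-simplices of `A`. -/
def vertex (n : ℕ) (i : Fin (n + 1)) : A _⦋n⦌ ⟶ A _⦋0⦌ := A.map (const ⦋0⦌ ⦋n⦌ i).op

theorem δ_vertex {n : ℕ} (i : Fin (n + 2)) (j : Fin (n + 1)) {k : Fin (n + 2)}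
    (h : i.succAbove j = k) : A.δ i ≫ vertex A n j = vertex A (n + 1) k :=
  map_op_comp_map_op (by rw [const_comp, ← h]; rfl)

theorem σ_δ_one : A.σ (n := 0) 0 ≫ A.δ 1 = 𝟙 _ := map_op_comp_map_op_eq_id (by decide)

theorem σ_δ_zero : A.σ (n := 0) 0 ≫ A.δ 0 = 𝟙 _ := map_op_comp_map_op_eq_id (by decide)

theorem δ_zero_δ_zero : A.δ (n := 1) 0 ≫ A.δ (n := 0) 0 = vertex A 2 2 :=
  map_op_comp_map_op (by decide)

theorem δ_zero_δ_one : A.δ (n := 1) 0 ≫ A.δ (n := 0) 1 = vertex A 2 1 :=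
  map_op_comp_map_op (by decide)

theorem δ_one_δ_zero : A.δ (n := 1) 1 ≫ A.δ (n := 0) 0 = vertex A 2 2 :=
  map_op_comp_map_op (by decide)

theorem δ_one_δ_one : A.δ (n := 1) 1 ≫ A.δ (n := 0) 1 = vertex A 2 0 :=
  map_op_comp_map_op (by decide)

theorem δ_two_δ_zero : A.δ (n := 1) 2 ≫ A.δ (n := 0) 0 = vertex A 2 1 :=
  map_op_comp_map_op (by decide)

theorem δ_two_δ_one : A.δ (n := 1) 2 ≫ A.δ (n := 0) 1 = vertex A 2 0 :=
  map_op_comp_map_op (by decide)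

/-- The edge from the `i`-th to the `j`-th vertex of the object of `n`-simplices of `A`. -/
def edge (n : ℕ) (i j : Fin (n + 1)) (h : i ≤ j) : A _⦋n⦌ ⟶ A _⦋1⦌ := A.map (mkOfLe i j h).op

theorem edge_δ_zero {n : ℕ} {i j : Fin (n + 1)} (h : i ≤ j) :
    edge A n i j h ≫ A.δ 0 = vertex A n j :=
  map_op_comp_map_op (by ext x; fin_cases x; rfl)

theorem edge_δ_one {n : ℕ} {i j : Fin (n + 1)} (h : i ≤ j) :
    edge A n i j h ≫ A.δ 1 = vertex A n i :=
  map_op_comp_map_op (by ext x; fin_cases x; rfl)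

variable {A}

theorem IsInternalCategory.isPullback_two (hA : IsInternalCategory A) :
    IsPullback (A.δ (n := 1) 0) (A.δ (n := 1) 2) (A.δ (n := 0) 1) (A.δ (n := 0) 0) := by
  have := hA.isPullback 0
  rwa [mkOfSucc_zero_eq_δ, show const ⦋0⦌ ⦋0 + 1⦌ 0 = δ 1 by decide] at this

theorem IsInternalCategory.isPullback_three (hA : IsInternalCategory A) :
    IsPullback (A.δ (n := 2) 0) (edge A 3 0 1 (Fin.zero_le _)) (vertex A 2 0)
      (A.δ (n := 0) 0) :=
  hA.isPullback 1

/-- A morphism `f : ∂₁ F ⟶ ∂₀ F` is unital if its restriction along `i₀` is the identity. -/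
def IsUnital {F : X.obj (op (A _⦋0⦌))}
    (f : (reindex X (A.δ (n := 0) 1)).obj F ⟶ (reindex X (A.δ (n := 0) 0)).obj F) : Prop :=
  pull X (A.σ (n := 0) 0) f (σ_δ_one A) (σ_δ_zero A) = 𝟙 _

/-- The cocycle condition on a morphism `f : ∂₁ F ⟶ ∂₀ F`, in the fibre over `A₂`. -/
def IsCocycle {F : X.obj (op (A _⦋0⦌))}
    (f : (reindex X (A.δ (n := 0) 1)).obj F ⟶ (reindex X (A.δ (n := 0) 0)).obj F) : Prop :=
  pull X (A.δ (n := 1) 1) f (δ_one_δ_one A) (δ_one_δ_zero A) =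
    pull X (A.δ (n := 1) 2) f (δ_two_δ_one A) (δ_two_δ_zero A) ≫
    pull X (A.δ (n := 1) 0) f (δ_zero_δ_one A) (δ_zero_δ_zero A)

theorem isUnital_iff_map {F : X.obj (op (A _⦋0⦌))}
    (f : (reindex X (A.δ (n := 0) 1)).obj F ⟶ (reindex X (A.δ (n := 0) 0)).obj F)
    (h₁ : (reindex X (A.σ (n := 0) 0)).obj ((reindex X (A.δ (n := 0) 1)).obj F) = F)
    (h₀ : F = (reindex X (A.σ (n := 0) 0)).obj ((reindex X (A.δ (n := 0) 0)).obj F)) :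
    IsUnital f ↔ (reindex X (A.σ (n := 0) 0)).map f = eqToHom h₁ ≫ eqToHom h₀ := by
  rw [map_eq_pull _ f (σ_δ_one A) (σ_δ_zero A), IsUnital]
  constructor
  · intro h
    simp [h]
  · intro h
    have := congrArg (fun k => eqToHom (reindex_obj X (σ_δ_one A) F).symm ≫ k ≫
      eqToHom (reindex_obj X (σ_δ_zero A) F)) h
    simpa using this

theorem isCocycle_iff_map {F : X.obj (op (A _⦋0⦌))}
    (f : (reindex X (A.δ (n := 0) 1)).obj F ⟶ (reindex X (A.δ (n := 0) 0)).obj F)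
    (h₀ : (reindex X (A.δ (n := 1) 1)).obj ((reindex X (A.δ (n := 0) 1)).obj F) =
      (reindex X (A.δ (n := 1) 2)).obj ((reindex X (A.δ (n := 0) 1)).obj F))
    (h₁ : (reindex X (A.δ (n := 1) 2)).obj ((reindex X (A.δ (n := 0) 0)).obj F) =
      (reindex X (A.δ (n := 1) 0)).obj ((reindex X (A.δ (n := 0) 1)).obj F))
    (h₂ : (reindex X (A.δ (n := 1) 0)).obj ((reindex X (A.δ (n := 0) 0)).obj F) =
      (reindex X (A.δ (n := 1) 1)).obj ((reindex X (A.δ (n := 0) 0)).obj F)) :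
    IsCocycle f ↔ (reindex X (A.δ (n := 1) 1)).map f =
      eqToHom h₀ ≫ (reindex X (A.δ (n := 1) 2)).map f ≫ eqToHom h₁ ≫
        (reindex X (A.δ (n := 1) 0)).map f ≫ eqToHom h₂ := by
  rw [map_eq_pull _ f (δ_one_δ_one A) (δ_one_δ_zero A),
    map_eq_pull _ f (δ_two_δ_one A) (δ_two_δ_zero A),
    map_eq_pull _ f (δ_zero_δ_one A) (δ_zero_δ_zero A), IsCocycle]
  constructor
  · intro h
    simp [h]
  · intro h
    have := congrArg (fun k => eqToHom (reindex_obj X (δ_one_δ_one A) F).symm ≫ k ≫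
      eqToHom (reindex_obj X (δ_one_δ_zero A) F)) h
    simpa using this

theorem Desc.isUnital (M : Desc (cosimplicialCat X A)) : IsUnital (A := A) M.hom :=
  (isUnital_iff_map (A := A) M.hom _ _).2 M.unit

theorem Desc.isCocycle (M : Desc (cosimplicialCat X A)) : IsCocycle (A := A) M.hom :=
  (isCocycle_iff_map (A := A) M.hom _ _ _).2 M.cocycle

/-- The descent datum given by a unital cocycle. -/
def Desc.ofIsCocycle {F : X.obj (op (A _⦋0⦌))}
    (f : (reindex X (A.δ (n := 0) 1)).obj F ⟶ (reindex X (A.δ (n := 0) 0)).obj F)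
    (h₁ : IsUnital f) (h₂ : IsCocycle f) : Desc (cosimplicialCat X A) where
  obj := F
  hom := f
  unit := (isUnital_iff_map f _ _).1 h₁
  cocycle := (isCocycle_iff_map f _ _ _).1 h₂

/-! ### Transposes and the unit of the monad -/

variable {Xhat : X.obj (op (A _⦋1⦌)) ⥤ X.obj (op (A _⦋0⦌))}
  (adj : Xhat ⊣ reindex X (A.δ (n := 0) 0))

/-- The transpose `X̂d₀ (Xd₁ F) ⟶ F` of a morphism `∂₁ F ⟶ ∂₀ F`. -/
def act {F G : X.obj (op (A _⦋0⦌))}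
    (f : (reindex X (A.δ (n := 0) 1)).obj F ⟶ (reindex X (A.δ (n := 0) 0)).obj G) :
    Xhat.obj ((reindex X (A.δ (n := 0) 1)).obj F) ⟶ G :=
  (adj.homEquiv _ _).symm f

/-- The universal morphism `∂₁ F ⟶ ∂₀ (X̂d₀ (Xd₁ F))`. -/
def eta (F : X.obj (op (A _⦋0⦌))) :
    (reindex X (A.δ (n := 0) 1)).obj F ⟶
      (reindex X (A.δ (n := 0) 0)).obj (Xhat.obj ((reindex X (A.δ (n := 0) 1)).obj F)) :=
  adj.unit.app _

theorem eta_act {F G : X.obj (op (A _⦋0⦌))}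
    (f : (reindex X (A.δ (n := 0) 1)).obj F ⟶ (reindex X (A.δ (n := 0) 0)).obj G) :
    eta adj F ≫ (reindex X (A.δ (n := 0) 0)).map (act adj f) = f :=
  (adj.homEquiv_unit _ _ _).symm.trans ((adj.homEquiv _ _).apply_symm_apply f)

theorem act_eta (F : X.obj (op (A _⦋0⦌))) : act adj (eta adj F) = 𝟙 _ := by
  rw [act, Equiv.symm_apply_eq, adj.homEquiv_id]
  rfl

theorem act_injective {F G : X.obj (op (A _⦋0⦌))} : Function.Injective (act adj (F := F) (G := G)) :=
  (adj.homEquiv _ _).symm.injective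

theorem map_act {F G H : X.obj (op (A _⦋0⦌))} (u : F ⟶ G)
    (g : (reindex X (A.δ (n := 0) 1)).obj G ⟶ (reindex X (A.δ (n := 0) 0)).obj H) :
    Xhat.map ((reindex X (A.δ (n := 0) 1)).map u) ≫ act adj g =
      act adj ((reindex X (A.δ (n := 0) 1)).map u ≫ g) :=
  (adj.homEquiv_naturality_left_symm _ _).symm

theorem act_comp {F G H : X.obj (op (A _⦋0⦌))} (u : G ⟶ H)
    (g : (reindex X (A.δ (n := 0) 1)).obj F ⟶ (reindex X (A.δ (n := 0) 0)).obj G) :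
    act adj g ≫ u = act adj (g ≫ (reindex X (A.δ (n := 0) 0)).map u) :=
  (adj.homEquiv_naturality_right_symm _ _).symm

theorem eta_naturality {F G : X.obj (op (A _⦋0⦌))} (u : F ⟶ G) :
    (reindex X (A.δ (n := 0) 1)).map u ≫ eta adj G = eta adj F ≫
      (reindex X (A.δ (n := 0) 0)).map (Xhat.map ((reindex X (A.δ (n := 0) 1)).map u)) :=
  adj.unit.naturality _

/-- The restriction of the universal morphism along the degeneracy `A₀ ⟶ A₁`. -/
def iota (F : X.obj (op (A _⦋0⦌))) :
    F ⟶ Xhat.obj ((reindex X (A.δ (n := 0) 1)).obj F) :=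
  ofId X (pull X (A.σ (n := 0) 0) (eta adj F) (σ_δ_one A) (σ_δ_zero A))

theorem iota_comp {F G : X.obj (op (A _⦋0⦌))}
    (a : Xhat.obj ((reindex X (A.δ (n := 0) 1)).obj F) ⟶ G) :
    iota adj F ≫ a = ofId X (pull X (A.σ (n := 0) 0)
      (eta adj F ≫ (reindex X (A.δ (n := 0) 0)).map a)
      (σ_δ_one A) (σ_δ_zero A)) := by
  rw [pull_comp _ _ _ _ (σ_δ_zero A), pull_map, ofId_comp, ofId_map]
  rfl

theorem comp_iota {F G : X.obj (op (A _⦋0⦌))} (u : F ⟶ G) :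
    u ≫ iota adj G = ofId X (pull X (A.σ (n := 0) 0)
      ((reindex X (A.δ (n := 0) 1)).map u ≫ eta adj G)
      (σ_δ_one A) (σ_δ_zero A)) := by
  rw [pull_comp _ _ _ _ (σ_δ_one A), pull_map, ofId_comp, ofId_map]
  rfl

theorem iota_naturality {F G : X.obj (op (A _⦋0⦌))} (u : F ⟶ G) :
    u ≫ iota adj G = iota adj F ≫ Xhat.map ((reindex X (A.δ (n := 0) 1)).map u) := by
  rw [iota_comp, comp_iota, eta_naturality]

/-- Since f is `eta` followed by Xd₀ of its transpose, restricting f along the degeneracy gives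
`iota` followed by that transpose. -/
theorem isUnital_iff {F : X.obj (op (A _⦋0⦌))}
    (f : (reindex X (A.δ (n := 0) 1)).obj F ⟶ (reindex X (A.δ (n := 0) 0)).obj F) :
    IsUnital f ↔ iota adj F ≫ act adj f = 𝟙 F := by
  rw [iota_comp, eta_act, ofId_eq_id_iff]
  rfl

/-! ### The free descent datum and the adjunction -/

variable (hX : HasSmallCoproducts X) (hA : IsInternalCategory A)

include hX hA

theorem hom_ext_of_pull_eta {F : X.obj (op (A _⦋0⦌))} {V : C} {s : A _⦋1⦌ ⟶ V}
    {K : X.obj (op V)} {v : A _⦋2⦌ ⟶ V} (hv : A.δ (n := 1) 0 ≫ s = v)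
    {φ φ' : (reindex X (A.δ (n := 0) 1)).obj
      (Xhat.obj ((reindex X (A.δ (n := 0) 1)).obj F)) ⟶ (reindex X s).obj K}
    (h : pull X (A.δ (n := 1) 2) (eta adj F) (δ_two_δ_one A) (δ_two_δ_zero A) ≫
        pull X (A.δ (n := 1) 0) φ (δ_zero_δ_one A) hv =
      pull X (A.δ (n := 1) 2) (eta adj F) (δ_two_δ_one A) (δ_two_δ_zero A) ≫
        pull X (A.δ (n := 1) 0) φ' (δ_zero_δ_one A) hv) : φ = φ' :=
  (hX.existsUnique_pull hA.isPullback_two adj (δ_two_δ_one A) (δ_two_δ_zero A)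
    (δ_zero_δ_one A) hv _).unique h rfl

theorem hom_ext_of_pull_edge_eta {F : X.obj (op (A _⦋0⦌))} {V : C} {s : A _⦋2⦌ ⟶ V}
    {K : X.obj (op V)} {v : A _⦋3⦌ ⟶ V} (hv : A.δ (n := 2) 0 ≫ s = v)
    {φ φ' : (reindex X (vertex A 2 0)).obj
      (Xhat.obj ((reindex X (A.δ (n := 0) 1)).obj F)) ⟶ (reindex X s).obj K}
    (h : pull X (edge A 3 0 1 (Fin.zero_le _)) (eta adj F) (edge_δ_one A _) (edge_δ_zero A _) ≫
        pull X (A.δ (n := 2) 0) φ (δ_vertex A 0 0 rfl) hv =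
      pull X (edge A 3 0 1 (Fin.zero_le _)) (eta adj F) (edge_δ_one A _) (edge_δ_zero A _) ≫
        pull X (A.δ (n := 2) 0) φ' (δ_vertex A 0 0 rfl) hv) : φ = φ' :=
  (hX.existsUnique_pull hA.isPullback_three adj (edge_δ_one A _) (edge_δ_zero A _)
    (δ_vertex A 0 0 rfl) hv _).unique h rfl

theorem existsUnique_theta (F : X.obj (op (A _⦋0⦌))) :
    ∃! θ : (reindex X (A.δ (n := 0) 1)).obj
        (Xhat.obj ((reindex X (A.δ (n := 0) 1)).obj F)) ⟶
      (reindex X (A.δ (n := 0) 0)).obj (Xhat.obj ((reindex X (A.δ (n := 0) 1)).obj F)),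
      pull X (A.δ (n := 1) 2) (eta adj F) (δ_two_δ_one A) (δ_two_δ_zero A) ≫
        pull X (A.δ (n := 1) 0) θ (δ_zero_δ_one A) (δ_zero_δ_zero A) =
      pull X (A.δ (n := 1) 1) (eta adj F) (δ_one_δ_one A) (δ_one_δ_zero A) :=
  hX.existsUnique_pull hA.isPullback_two adj _ _ _ _ _

/-- The descent datum on the free object `X̂d₀ (Xd₁ F)`. -/
noncomputable def theta (F : X.obj (op (A _⦋0⦌))) :
    (reindex X (A.δ (n := 0) 1)).obj (Xhat.obj ((reindex X (A.δ (n := 0) 1)).obj F)) ⟶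
      (reindex X (A.δ (n := 0) 0)).obj (Xhat.obj ((reindex X (A.δ (n := 0) 1)).obj F)) :=
  (existsUnique_theta adj hX hA F).choose

theorem eta_theta (F : X.obj (op (A _⦋0⦌))) :
    pull X (A.δ (n := 1) 2) (eta adj F) (δ_two_δ_one A) (δ_two_δ_zero A) ≫
        pull X (A.δ (n := 1) 0) (theta adj hX hA F) (δ_zero_δ_one A) (δ_zero_δ_zero A) =
      pull X (A.δ (n := 1) 1) (eta adj F) (δ_one_δ_one A) (δ_one_δ_zero A) :=
  (existsUnique_theta adj hX hA F).choose_spec.1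

/-- The defining equation of `theta`, read at a generalized 2-simplex `t` with edges `a`, `b` and
composite `c`. -/
theorem pull_eta_theta (F : X.obj (op (A _⦋0⦌))) {U : C} (t : U ⟶ A _⦋2⦌)
    {a b c : U ⟶ A _⦋1⦌} (ha : t ≫ A.δ 2 = a) (hb : t ≫ A.δ 0 = b) (hc : t ≫ A.δ 1 = c)
    {v₀ v₁ v₂ : U ⟶ A _⦋0⦌} (ha₁ : a ≫ A.δ 1 = v₀) (ha₀ : a ≫ A.δ 0 = v₁)
    (hb₁ : b ≫ A.δ 1 = v₁) (hb₀ : b ≫ A.δ 0 = v₂) (hc₁ : c ≫ A.δ 1 = v₀)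
    (hc₀ : c ≫ A.δ 0 = v₂) :
    pull X a (eta adj F) ha₁ ha₀ ≫ pull X b (theta adj hX hA F) hb₁ hb₀ =
      pull X c (eta adj F) hc₁ hc₀ := by
  have e₀ : t ≫ vertex A 2 0 = v₀ := by
    rw [← ha₁, ← ha, Category.assoc, δ_two_δ_one]
  have e₁ : t ≫ vertex A 2 1 = v₁ := by
    rw [← ha₀, ← ha, Category.assoc, δ_two_δ_zero]
  have e₂ : t ≫ vertex A 2 2 = v₂ := by
    rw [← hb₀, ← hb, Category.assoc, δ_zero_δ_zero]
  have := congrArg (fun φ => pull X t φ e₀ e₂) (eta_theta adj hX hA F)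
  rwa [pull_comp t _ _ e₀ e₁ e₂, pull_pull _ _ _ _ _ _ _ ha, pull_pull _ _ _ _ _ _ _ hb,
    pull_pull _ _ _ _ _ _ _ hc] at this

/-- Descent data restrict the universal morphism compatibly with morphisms out of the free
object. -/
theorem eta_theta_map {F G : X.obj (op (A _⦋0⦌))}
    (a : Xhat.obj ((reindex X (A.δ (n := 0) 1)).obj F) ⟶ G) :
    pull X (A.δ (n := 1) 2) (eta adj F) (δ_two_δ_one A) (δ_two_δ_zero A) ≫
        pull X (A.δ (n := 1) 0) (theta adj hX hA F ≫ (reindex X (A.δ (n := 0) 0)).map a)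
          (δ_zero_δ_one A) (δ_zero_δ_zero A) =
      pull X (A.δ (n := 1) 1) (eta adj F ≫ (reindex X (A.δ (n := 0) 0)).map a)
        (δ_one_δ_one A) (δ_one_δ_zero A) := by
  rw [pull_comp _ _ _ _ (δ_zero_δ_zero A), pull_map, ← Category.assoc, eta_theta,
    pull_comp _ _ _ _ (δ_one_δ_zero A), pull_map]

omit hX hA in
theorem eta_map {F G H : X.obj (op (A _⦋0⦌))}
    (a : Xhat.obj ((reindex X (A.δ (n := 0) 1)).obj F) ⟶ G)
    (g : (reindex X (A.δ (n := 0) 1)).obj G ⟶ (reindex X (A.δ (n := 0) 0)).obj H) :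
    pull X (A.δ (n := 1) 2) (eta adj F) (δ_two_δ_one A) (δ_two_δ_zero A) ≫
        pull X (A.δ (n := 1) 0) ((reindex X (A.δ (n := 0) 1)).map a ≫ g)
          (δ_zero_δ_one A) (δ_zero_δ_zero A) =
      pull X (A.δ (n := 1) 2) (eta adj F ≫ (reindex X (A.δ (n := 0) 0)).map a)
        (δ_two_δ_one A) (δ_two_δ_zero A) ≫
      pull X (A.δ (n := 1) 0) g (δ_zero_δ_one A) (δ_zero_δ_zero A) := by
  rw [pull_comp _ _ _ _ (δ_zero_δ_one A), pull_map, pull_comp _ _ _ _ (δ_two_δ_zero A),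
    pull_map, Category.assoc]

theorem theta_naturality {F G : X.obj (op (A _⦋0⦌))} (u : F ⟶ G) :
    theta adj hX hA F ≫ (reindex X (A.δ (n := 0) 0)).map
        (Xhat.map ((reindex X (A.δ (n := 0) 1)).map u)) =
      (reindex X (A.δ (n := 0) 1)).map (Xhat.map ((reindex X (A.δ (n := 0) 1)).map u)) ≫
        theta adj hX hA G := by
  refine hom_ext_of_pull_eta adj hX hA (δ_zero_δ_zero A) ?_
  rw [eta_theta_map, eta_map, ← eta_naturality, pull_comp _ _ _ _ (δ_two_δ_one A), Category.assoc,
    eta_theta, pull_comp _ _ _ _ (δ_one_δ_one A), pull_map, pull_map]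

/-- A morphism `f : ∂₁ F ⟶ ∂₀ F` is a cocycle if and only if its transpose is compatible with the
descent datum on the free object. -/
theorem isCocycle_iff {F : X.obj (op (A _⦋0⦌))}
    (f : (reindex X (A.δ (n := 0) 1)).obj F ⟶ (reindex X (A.δ (n := 0) 0)).obj F) :
    IsCocycle f ↔ theta adj hX hA F ≫ (reindex X (A.δ (n := 0) 0)).map (act adj f) =
      (reindex X (A.δ (n := 0) 1)).map (act adj f) ≫ f := by
  have h₁ := eta_theta_map adj hX hA (act adj f)
  have h₂ := eta_map adj (act adj f) f
  rw [eta_act] at h₁ h₂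
  constructor
  · intro h
    exact hom_ext_of_pull_eta adj hX hA (δ_zero_δ_zero A) (h₁.trans (Eq.trans h h₂.symm))
  · intro h
    exact h₁.symm.trans (Eq.trans (by rw [h]) h₂)

theorem isUnital_theta (F : X.obj (op (A _⦋0⦌))) : IsUnital (theta adj hX hA F) := by
  have h : A.δ (n := 0) 0 ≫ A.σ (n := 0) 0 ≫ A.δ 1 = A.δ 0 := by
    rw [σ_δ_one, Category.comp_id]
  have h' : A.δ (n := 0) 0 ≫ A.σ (n := 0) 0 ≫ A.δ 0 = A.δ 0 := by
    rw [σ_δ_zero, Category.comp_id]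
  -- On the 2-simplex whose second edge is an identity, `eta` followed by the restricted `theta` is
  -- `eta`; by adjunction the restriction is the identity.
  have key := pull_eta_theta adj hX hA F (A.σ (n := 1) 1) (a := 𝟙 _)
    (b := A.δ (n := 0) 0 ≫ A.σ (n := 0) 0) (c := 𝟙 _)
    (map_op_comp_map_op_eq_id (by decide))
    ((map_op_comp_map_op (h := σ 0 ≫ δ 0) (by decide)).trans (map_op_comp_map_op rfl).symm)
    (map_op_comp_map_op_eq_id (by decide)) (Category.id_comp _) (Category.id_comp _)
    ((Category.assoc _ _ _).trans h) ((Category.assoc _ _ _).trans h')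
    (Category.id_comp _) (Category.id_comp _)
  rw [pull_eq_self _ rfl, ← pull_pull (A.δ (n := 0) 0) (A.σ (n := 0) 0) _ (σ_δ_one A)
    (σ_δ_zero A) (Category.comp_id _) (Category.comp_id _) rfl, ← map_ofId] at key
  rw [IsUnital, ← ofId_eq_id_iff]
  apply (adj.homEquiv _ _).injective
  rw [adj.homEquiv_unit, adj.homEquiv_unit]
  refine Eq.trans key ?_
  rw [CategoryTheory.Functor.map_id]
  exact (Category.comp_id _).symm

theorem isCocycle_theta (F : X.obj (op (A _⦋0⦌))) : IsCocycle (theta adj hX hA F) := by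
  refine hom_ext_of_pull_edge_eta adj hX hA (v := vertex A 3 3) (δ_vertex A 0 2 rfl) ?_
  have hδ (i : Fin 4) (j : Fin 3) (k l : Fin 4) (h : k ≤ l) (w : δ j ≫ δ i = mkOfLe k l h) :
      A.δ (n := 2) i ≫ A.δ (n := 1) j = edge A 3 k l h :=
    map_op_comp_map_op w
  rw [pull_comp _ _ _ _ (δ_vertex A (n := 2) 0 1 (k := 2) rfl),
    pull_pull _ _ _ _ _ _ _ (hδ 0 1 1 3 (by decide) (by decide)),
    pull_pull _ _ _ _ _ _ _ (hδ 0 2 1 2 (by decide) (by decide)),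
    pull_pull _ _ _ _ _ _ _ (hδ 0 0 2 3 (by decide) (by decide))]
  refine Eq.trans ?_ (Category.assoc _ _ _)
  -- Writing ij for an edge of the 3-simplex: η₀₁θ₁₃ = η₀₃ on the face 013, while η₀₁θ₁₂θ₂₃ = η₀₂θ₂₃
  -- = η₀₃ by the faces 012 and 023.
  rw [pull_eta_theta adj hX hA F (A.δ (n := 2) 2) (hδ 2 2 0 1 _ (by decide))
      (hδ 2 0 1 3 _ (by decide)) (hδ 2 1 0 3 (by decide) (by decide)) _ _ _ _
      (edge_δ_one A _) (edge_δ_zero A _),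
    pull_eta_theta adj hX hA F (A.δ (n := 2) 3) (hδ 3 2 0 1 _ (by decide))
      (hδ 3 0 1 2 _ (by decide)) (hδ 3 1 0 2 (by decide) (by decide)) _ _ _ _
      (edge_δ_one A _) (edge_δ_zero A _),
    pull_eta_theta adj hX hA F (A.δ (n := 2) 1) (hδ 1 2 0 2 _ (by decide))
      (hδ 1 0 2 3 _ (by decide)) (hδ 1 1 0 3 (by decide) (by decide)) _ _ _ _
      (edge_δ_one A _) (edge_δ_zero A _)]

/-- Evaluate the equation for `theta` on the 2-simplex whose first edge is an identity, where `eta`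
restricts to `iota`. This gives the left triangle identity. -/
theorem map_iota_theta (F : X.obj (op (A _⦋0⦌))) :
    (reindex X (A.δ (n := 0) 1)).map (iota adj F) ≫ theta adj hX hA F = eta adj F := by
  have h : A.δ (n := 0) 1 ≫ A.σ (n := 0) 0 ≫ A.δ 1 = A.δ 1 := by
    rw [σ_δ_one, Category.comp_id]
  have h' : A.δ (n := 0) 1 ≫ A.σ (n := 0) 0 ≫ A.δ 0 = A.δ 1 := by
    rw [σ_δ_zero, Category.comp_id]
  have key := pull_eta_theta adj hX hA F (A.σ (n := 1) 0)
    (a := A.δ (n := 0) 1 ≫ A.σ (n := 0) 0) (b := 𝟙 _) (c := 𝟙 _)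
    ((map_op_comp_map_op (h := σ 0 ≫ δ 1) (by decide)).trans (map_op_comp_map_op rfl).symm)
    (map_op_comp_map_op_eq_id (by decide)) (map_op_comp_map_op_eq_id (by decide))
    ((Category.assoc _ _ _).trans h) ((Category.assoc _ _ _).trans h')
    (Category.id_comp _) (Category.id_comp _) (Category.id_comp _) (Category.id_comp _)
  rw [pull_eq_self _ rfl, pull_eq_self _ rfl, ← pull_pull (A.δ (n := 0) 1) (A.σ (n := 0) 0) _
    (σ_δ_one A) (σ_δ_zero A) (Category.comp_id _) (Category.comp_id _) rfl, ← map_ofId] at key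
  exact key

/-- The free descent datum functor. -/
noncomputable def freeDesc : X.obj (op (A _⦋0⦌)) ⥤ Desc (cosimplicialCat X A) where
  obj F := Desc.ofIsCocycle (theta adj hX hA F) (isUnital_theta adj hX hA F)
    (isCocycle_theta adj hX hA F)
  map u :=
    { hom := Xhat.map ((reindex X (A.δ (n := 0) 1)).map u)
      comm := theta_naturality adj hX hA u }
  map_id F := Desc.Hom.ext ((reindex X (A.δ (n := 0) 1) ⋙ Xhat).map_id F)
  map_comp u v := Desc.Hom.ext ((reindex X (A.δ (n := 0) 1) ⋙ Xhat).map_comp u v)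

/-- The free descent datum functor is left adjoint to the forgetful functor. -/
noncomputable def freeDescAdj : freeDesc adj hX hA ⊣ descForget X A where
  unit :=
    { app := fun F => iota adj F
      naturality := fun _ _ u => iota_naturality adj u }
  counit :=
    { app := fun M =>
        { hom := act adj M.hom
          comm := (isCocycle_iff adj hX hA (F := M.obj) M.hom).1 M.isCocycle }
      naturality := fun M N u => Desc.Hom.ext <|
        (map_act adj u.hom N.hom).trans <|
          (congrArg (act adj) u.comm.symm).trans (act_comp adj u.hom M.hom).symm }
  left_triangle_components F := Desc.Hom.ext <| by
    refine (map_act adj (iota adj F) (theta adj hX hA F)).trans ?_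
    rw [map_iota_theta, act_eta]
    rfl
  right_triangle_components M := (isUnital_iff adj (F := M.obj) M.hom).1 M.isUnital

end Free

/-! ### The comparison functor -/

section Monadic

variable {C : Type u₁} [Category.{v₁} C] {X : Cᵒᵖ ⥤ Cat.{v₂, u₂}} {A : SimplicialObject C}
  {Xhat : X.obj (op (A _⦋1⦌)) ⥤ X.obj (op (A _⦋0⦌))}
  (adj : Xhat ⊣ reindex X (A.δ (n := 0) 0)) (hX : HasSmallCoproducts X)
  (hA : IsInternalCategory A)

theorem comparison_obj_injective :
    Function.Injective (Monad.comparison (freeDescAdj adj hX hA)).obj := by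
  intro M N h
  obtain ⟨F, f, _, _⟩ := M
  obtain ⟨G, g, _, _⟩ := N
  obtain rfl : F = G := congrArg Monad.Algebra.A h
  have h' : act adj f = act adj g := by
    injection h
  obtain rfl := act_injective adj h'
  rfl

theorem comparison_obj_surjective :
    Function.Surjective (Monad.comparison (freeDescAdj adj hX hA)).obj := by
  intro N
  obtain ⟨F, a, ha, ha'⟩ := N
  change Xhat.obj ((reindex X (A.δ (n := 0) 1)).obj F) ⟶ F at a
  have h₁ : iota adj F ≫ a = 𝟙 F := ha
  -- The multiplication is the counit at the free object, namely the transpose of `theta`.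
  have h₂ : act adj (theta adj hX hA F) ≫ a =
    Xhat.map ((reindex X (A.δ (n := 0) 1)).map a) ≫ a := ha'
  obtain ⟨f, rfl⟩ : ∃ f, act adj f = a := (adj.homEquiv _ _).symm.surjective a
  have hf₁ : IsUnital f := (isUnital_iff adj f).2 h₁
  have hf₂ : IsCocycle f := by
    rw [isCocycle_iff adj hX hA]
    rw [act_comp, map_act] at h₂
    exact act_injective adj h₂
  exact ⟨Desc.ofIsCocycle f hf₁ hf₂, rfl⟩

instance comparison_faithful : (Monad.comparison (freeDescAdj adj hX hA)).Faithful where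
  map_injective h := Desc.Hom.ext (congrArg Monad.Algebra.Hom.f h)

instance comparison_full : (Monad.comparison (freeDescAdj adj hX hA)).Full where
  map_surjective {M N} u := by
    let v : M.obj ⟶ N.obj := u.f
    exact ⟨{ hom := v
             -- The transpose of the descent condition on `v` is exactly the condition for an
             -- algebra morphism.
             comm := (act_injective adj <| (map_act adj v N.hom).symm.trans <|
               u.h.trans (act_comp adj v M.hom)).symm }, rfl⟩

theorem comparison_isEquivalence :
    (Monad.comparison (freeDescAdj adj hX hA)).IsEquivalence where
  essSurj := ⟨fun N => by
    obtain ⟨M, hM⟩ := comparison_obj_surjective adj hX hA N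
    exact ⟨M, ⟨eqToIso hM⟩⟩⟩

end Monadic

end ParamCat

theorem proposition4p5 {C : Type u₁} [Category.{v₁} C] [Limits.HasFiniteLimits C]
    (X : Cᵒᵖ ⥤ Cat.{v₂, u₂}) (hX : ParamCat.HasSmallCoproducts X)
    (A : SimplicialObject C) (hA : ParamCat.IsInternalCategory A)
    (Xhat : X.obj (op (A _⦋1⦌)) ⥤ X.obj (op (A _⦋0⦌)))
    (adj : Xhat ⊣ ParamCat.reindex X (A.δ (n := 0) 0)) :
    ∃ m : MonadicRightAdjoint (ParamCat.descForget X A),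
      m.adj.toMonad.toFunctor = ParamCat.reindex X (A.δ (n := 0) 1) ⋙ Xhat ∧
      Function.Bijective (Monad.comparison m.adj).obj :=
  ⟨{ L := ParamCat.freeDesc adj hX hA
     adj := ParamCat.freeDescAdj adj hX hA
     -- The free datum lives on X̂d₀(Xd₁F) itself, so the equality of functors is definitional.
     eqv := ParamCat.comparison_isEquivalence adj hX hA }, rfl,
    ParamCat.comparison_obj_injective adj hX hA, ParamCat.comparison_obj_surjective adj hX hA⟩
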